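/- **Conventions.** A name is an infinite sequence $p\in\mathbb N^{\mathbb N}$; a representation $\delta$ of a set $X$ is a partial map from $\mathbb N^{\mathbb N}$ to $X$. A partial function $F$ on $\mathbb N^{\mathbb N}$ is computable if there is a computable map $g$ on finite words, monotone for the prefix order, such that $F(p)$ is the limit of the words $g(p_0\dots p_{n-1})$ for all $p\in\operatorname{dom}F$. A map $f:X\to Y$ is $(\delta,\delta')$-computable if some computable $F$ satisfies $\delta'(F(p))=f(\delta(p))$ for all $p\in\operatorname{dom}\delta$. We use $\delta_{\mathbb N}(p)=p_0$, the function space representation $[\delta\to\delta']$ (a name of $f$ is the table of a monotone word function realizing $f$), $\delta^{\mathbb N}=[\delta_{\mathbb N}\to\delta]$, and pairings $\langle p,q\rangle$, $\langle p_0,p_1,\dots\rangle$ of names. Let $\mathbb F\in\{\mathbb R,\mathbb C\}$, with standard numberings of the rationals in $\mathbb R$ and of the (Gaussian) rationals in $\mathbb F$. For a dense sequence $\alpha$ in a metric space, the Cauchy representation is given by $\delta(p)=\lim_i\alpha(p_i)$, defined when the limit exists and $d(\alpha(p_i),\alpha(p_j))<2^{-i}$ for all $j>i$; this gives $\delta_{\mathbb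 R}$ and $\delta_{\mathbb F}$. A computable Hilbert space is a Hilbert space $X$ over $\mathbb F$ with a sequence $(x_n)$ of dense linear span such that, for the standard numbering $\alpha$ of the finite rational linear combinations of the $x_n$, the double sequence $\|\alpha(m)-\alpha(n)\|$ of reals is computable; $\delta_X$ is the Cauchy representation for $\alpha$. The space $l^2$ carries its unit vectors as fundamental sequence. A computable orthonormal basis is an orthonormal basis that is a computable sequence. **Theorem 3.14.** Let $H$ and $H_i$ $(i\in\mathbb N)$ be computable Hilbert spaces over $\mathbb F$, and let $\{e_{ik}:k\in\mathbb N\}$ be a computable orthonormal basis of $H_i$ for each $i$. Let $\{\Lambda_i\}$ be a computable $g$-frame for $H$ with respect to $\{H_i\}$: each $\Lambda_i:H\to H_i$ is bounded and linear, from a name of $i$ one can compute a $[\delta_H\to\delta_{H_i}]$-name of $\Lambda_i$, and there are constants $0<A\le B<\infty$ with $A\|f\|^2\le\sum_i\|\Lambda_i f\|^2\le B\|f\|^2$ for all $f\in H$. Suppose that the analysis operator $H\to l^2$, $f\mapsto(\langle f,\Lambda_i^*e_{ik}\rangle)_{i,k}$, of the frame $\{\Lambda_i^*e_{ik}:i,k\in\mathbb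 N\}$ (written as a sequence through a computable pairing $\mathbb N^2\cong\mathbb N$) is $(\delta_H,\delta_{l^2})$-computable. Then the analysis operator $$T^*:H\to\Big(\sum_{i\in\mathbb N}\oplus H_i\Big)_{l^2},\qquad T^*(f)=(\Lambda_i f)_{i\in\mathbb N},$$ is computable with respect to $\delta_H$ on $H$ and each of the following three representations of $(\sum\oplus H_i)_{l^2}$: 1. the coordinatewise representation, in which $\langle\langle p_0,p_1,\dots\rangle,q\rangle$ is a name of $(f_i)$ if and only if $\delta_{H_i}(p_i)=f_i$ for all $i$ and $\delta_{\mathbb R}(q)=\sum_i\|f_i\|^2$; 2. the Fourier representation, in which $\langle p,q\rangle$ is a name of $(f_i)$ if and only if $(\delta_{\mathbb F}^{\mathbb N})^{\mathbb N}(p)=((\langle f_i,e_{ij}\rangle)_j)_i$ and $\delta_{\mathbb R}(q)=\sum_i\|f_i\|^2$; 3. the Cauchy representation induced by the orthonormal basis $(E_{ij})_{i,j}$, where $E_{ij}$ has $i$-th coordinate $e_{ij}$ and all other coordinates $0$ (written as a sequence through the same pairing). -/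

import Mathlib

open Filter Topology

noncomputable section

namespace TTE

/-! ### Computable functions on infinite sequences

Names are elements of Baire space `ℕ → ℕ`, i.e. infinite sequences over the alphabet `ℕ`. -/

/-- The word consisting of the first `n` symbols of the infinite sequence `p`. -/
def pre (p : ℕ → ℕ) (n : ℕ) : List ℕ := (List.range n).map p

/-- A word function is monotone if extending the input word extends the output word. -/
def MonotoneWord (g : List ℕ → List ℕ) : Prop :=
  ∀ w w' : List ℕ, w <+: w' → g w <+: g w'

/-- `Outputs g p r`: on the infinite input `p`, the (monotone) word function `g` produces the
infinite output `r`. Here `g w` is the part of the one-way output that has been written after the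
word `w` has been read from the input. -/
def Outputs (g : List ℕ → List ℕ) (p r : ℕ → ℕ) : Prop :=
  (∀ n, g (pre p n) = pre r (g (pre p n)).length) ∧ ∀ N, ∃ n, N ≤ (g (pre p n)).length

/-- A naming system of a set `X`: `δ p x` means that `p` is in the domain of the partial map `δ`
and that `δ(p) = x`. -/
abbrev Rep (X : Type*) := (ℕ → ℕ) → X → Prop

/-- The partial function on infinite sequences given by `g` realizes `f`: it maps every `δ`-name of
a point `x` to a `δ'`-name of `f x`. -/
def Realizes {X Y : Type*} (g : List ℕ → List ℕ) (δ : Rep X) (δ' : Rep Y) (f : X → Y) : Prop :=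
  ∀ p x, δ p x → ∃ r, Outputs g p r ∧ δ' r (f x)

/-- `(δ, δ')`-computability of a function: it is realized by a computable partial function on
infinite sequences, that is, by the one given by a computable monotone word function. -/
def ComputableMap {X Y : Type*} (δ : Rep X) (δ' : Rep Y) (f : X → Y) : Prop :=
  ∃ g : List ℕ → List ℕ, Computable g ∧ MonotoneWord g ∧ Realizes g δ δ' f

/-! ### Constructions of representations -/

/-- The representation of the natural numbers. -/
def natRep : Rep ℕ := fun p n => p 0 = n

/-- `r = ⟨p, q⟩` with `p = left r` and `q = right r`. -/
def left (r : ℕ → ℕ) : ℕ → ℕ := fun n => r (2 * n)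

/-- `r = ⟨p, q⟩` with `p = left r` and `q = right r`. -/
def right (r : ℕ → ℕ) : ℕ → ℕ := fun n => r (2 * n + 1)

/-- `r = ⟨p₀, p₁, p₂, …⟩` with `pᵢ = component r i`. -/
def component (r : ℕ → ℕ) (i : ℕ) : ℕ → ℕ := fun n => r (Nat.pair i n)

/-- The product representation. -/
def prodRep {X Y : Type*} (δ : Rep X) (δ' : Rep Y) : Rep (X × Y) :=
  fun r z => δ (left r) z.1 ∧ δ' (right r) z.2

/-- The word function whose table of values is the infinite sequence `q`
(words are numbered bijectively by natural numbers). -/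
def table (q : ℕ → ℕ) : List ℕ → List ℕ :=
  fun w => Denumerable.ofNat (List ℕ) (q (Encodable.encode w))

/-- The function space representation `[δ → δ']`: a name of `f` is the table of a monotone
word function that realizes `f`. -/
def funRep {X Y : Type*} (δ : Rep X) (δ' : Rep Y) : Rep (X → Y) :=
  fun q f => MonotoneWord (table q) ∧ Realizes (table q) δ δ' f

/-- The representation `δ^ℕ = [δ_ℕ → δ]` of the set of sequences. -/
def seqRep {X : Type*} (δ : Rep X) : Rep (ℕ → X) := funRep natRep δ

/-- The Cauchy representation induced by a dense sequence `α`: a name of `x` is a sequence of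
indices `nᵢ` such that `α nᵢ` converges to `x` and `d(α nᵢ, α nⱼ) < 2⁻ⁱ` for all `j > i`. -/
def cauchyRep {X : Type*} [MetricSpace X] (α : ℕ → X) : Rep X :=
  fun p x => (∀ i j, i < j → dist (α (p i)) (α (p j)) < (1 / 2 : ℝ) ^ i) ∧
    Tendsto (fun i => α (p i)) atTop (𝓝 x)

/-- The numbering `⟨i, ⟨j, k⟩⟩ ↦ (i - j) / (k + 1)` of the rational numbers. -/
def ratNum (n : ℕ) : ℝ :=
  ((n.unpair.1 : ℝ) - (n.unpair.2.unpair.1 : ℝ)) / ((n.unpair.2.unpair.2 : ℝ) + 1)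

/-- The Cauchy representation of the real numbers. -/
def realRep : Rep ℝ := cauchyRep ratNum

/-- `(X, d, α)` is a computable metric space. -/
structure IsComputableMetric {X : Type*} [MetricSpace X] (α : ℕ → X) : Prop where
  dense : DenseRange α
  computable_dist :
    ComputableMap (prodRep natRep natRep) realRep (fun z : ℕ × ℕ => dist (α z.1) (α z.2))

section Scalars

variable (𝕜 : Type*) [RCLike 𝕜]

/-- The numbering `⟨m, n⟩ ↦ q_m + i q_n` of a dense subset of `𝕜` (the imaginary unit `RCLike.I`
is `0` if `𝕜 = ℝ`). -/
def scalarNum (n : ℕ) : 𝕜 :=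
  (ratNum n.unpair.1 : 𝕜) + (ratNum n.unpair.2 : 𝕜) * RCLike.I

/-- The Cauchy representation of the scalar field. -/
def scalarRep : Rep 𝕜 := cauchyRep (scalarNum 𝕜)

variable {H : Type*} [NormedAddCommGroup H] [InnerProductSpace 𝕜 H]

/-- The numbering `⟨n₀, …, n_{k-1}⟩ ↦ ∑_{i<k} α_𝕜(nᵢ) eᵢ` of the rational linear combinations of
a sequence `e` of vectors. -/
def comboNum (e : ℕ → H) (n : ℕ) : H :=
  ∑ i : Fin (Denumerable.ofNat (List ℕ) n).length,
    scalarNum 𝕜 ((Denumerable.ofNat (List ℕ) n).get i) • e i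

/-- The Cauchy representation of a space with fundamental sequence `e`. -/
def normedRep (e : ℕ → H) : Rep H := cauchyRep (comboNum 𝕜 e)

/-- The Hilbert space `H`, together with the fundamental sequence `e`, is a computable Hilbert
space (separability follows from the density of the span). -/
structure IsComputableHilbert [CompleteSpace H] (e : ℕ → H) : Prop where
  dense_span : Dense (Submodule.span 𝕜 (Set.range e) : Set H)
  computable : IsComputableMetric (comboNum 𝕜 e)

/-- `b` is a computable orthonormal basis of the computable Hilbert space `(H, e)`: an orthonormal
basis that is a computable sequence in `H`. -/
structure IsComputableONB (e b : ℕ → H) : Prop where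
  orthonormal : Orthonormal 𝕜 b
  dense_span : Dense (Submodule.span 𝕜 (Set.range b) : Set H)
  computable : ComputableMap natRep (normedRep 𝕜 e) b

/-! ### Frames and analysis operators -/

/-- Frames. (Mathlib's inner product is conjugate-linear in the first variable, so that the
usual `⟨f, fᵢ⟩`, linear in `f`, is `inner 𝕜 (g i) f`.) -/
def IsFrame (g : ℕ → H) : Prop :=
  ∃ A B : ℝ, 0 < A ∧ 0 < B ∧ ∀ f : H, Summable (fun i => ‖inner 𝕜 (g i) f‖ ^ 2) ∧
    A * ‖f‖ ^ 2 ≤ ∑' i, ‖inner 𝕜 (g i) f‖ ^ 2 ∧ ∑' i, ‖inner 𝕜 (g i) f‖ ^ 2 ≤ B * ‖f‖ ^ 2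

variable {𝕜}

theorem memlp_two_of_summable {E : ℕ → Type*} [∀ i, NormedAddCommGroup (E i)] {x : ∀ i, E i}
    (h : Summable (fun i => ‖x i‖ ^ 2)) : Memℓp x 2 := by
  refine memℓp_gen ?_
  simpa using h

/-- The analysis operator `f ↦ (⟨f, gᵢ⟩)ᵢ` of a frame, with values in `l²`. -/
def frameAnalysis {g : ℕ → H} (hg : IsFrame 𝕜 g) (f : H) : lp (fun _ : ℕ => 𝕜) 2 :=
  ⟨fun i => inner 𝕜 (g i) f, by
    obtain ⟨A, B, -, -, h⟩ := hg
    exact memlp_two_of_summable (h f).1⟩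

variable (𝕜) in
/-- The unit vectors of `l²`; they are the fundamental sequence of the computable Hilbert space
`l²`. -/
def unitVec (n : ℕ) : lp (fun _ : ℕ => 𝕜) 2 := lp.single 2 n (1 : 𝕜)

variable {K : ℕ → Type*} [∀ i, NormedAddCommGroup (K i)] [∀ i, InnerProductSpace 𝕜 (K i)]

/-- g-frames. -/
def IsGFrame (Λ : ∀ i, H →L[𝕜] K i) : Prop :=
  ∃ A B : ℝ, 0 < A ∧ A ≤ B ∧ ∀ f : H, Summable (fun i => ‖Λ i f‖ ^ 2) ∧
    A * ‖f‖ ^ 2 ≤ ∑' i, ‖Λ i f‖ ^ 2 ∧ ∑' i, ‖Λ i f‖ ^ 2 ≤ B * ‖f‖ ^ 2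

/-- The analysis operator `f ↦ (Λᵢ f)ᵢ` of a g-frame, with values in the `l²`-direct sum. -/
def gAnalysis {Λ : ∀ i, H →L[𝕜] K i} (hΛ : IsGFrame Λ) (f : H) : lp K 2 :=
  ⟨fun i => Λ i f, by
    obtain ⟨A, B, -, -, h⟩ := hΛ
    exact memlp_two_of_summable (h f).1⟩

variable (𝕜) in
/-- The representation `δ*` of the (disjoint) union of the spaces `L(H, Kᵢ)`: a name of an element
of `L(H, Kᵢ)` is a pair consisting of a name of `i` and a name of it as a continuous function. -/
def operatorRep (d : ℕ → H) (e : ∀ i, ℕ → K i) : Rep (Σ i, H →L[𝕜] K i) :=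
  fun r F => natRep (left r) F.1 ∧
    funRep (normedRep 𝕜 d) (normedRep 𝕜 (e F.1)) (right r) (fun f => F.2 f)

/-- `Λ` is a computable g-frame for `(H, d)` with respect to the spaces `(Kᵢ, eᵢ)`. -/
structure IsComputableGFrame (d : ℕ → H) (e : ∀ i, ℕ → K i) (Λ : ∀ i, H →L[𝕜] K i) : Prop where
  computable :
    ComputableMap natRep (operatorRep 𝕜 d e) (fun i => (⟨i, Λ i⟩ : Σ i, H →L[𝕜] K i))
  isGFrame : IsGFrame Λ

/-- The family `Λᵢ* bᵢₖ`, `i, k ∈ ℕ`, as a sequence, through the pairing of natural numbers. -/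
def inducedFrame [CompleteSpace H] [∀ i, CompleteSpace (K i)] (Λ : ∀ i, H →L[𝕜] K i)
    (b : ∀ i, ℕ → K i) (n : ℕ) : H :=
  ContinuousLinearMap.adjoint (Λ n.unpair.1) (b n.unpair.1 n.unpair.2)

theorem hasSum_sq_inner {E : Type*} [NormedAddCommGroup E] [InnerProductSpace 𝕜 E]
    [CompleteSpace E] {b : ℕ → E} (hb : Orthonormal 𝕜 b)
    (hd : Dense (Submodule.span 𝕜 (Set.range b) : Set E)) (x : E) :
    HasSum (fun k => ‖inner 𝕜 (b k) x‖ ^ 2) (‖x‖ ^ 2) := by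
  have hsp : ⊤ ≤ (Submodule.span 𝕜 (Set.range b)).topologicalClosure := by
    rw [(Submodule.dense_iff_topologicalClosure_eq_top).1 hd]
  have h := (HilbertBasis.mk hb hsp).hasSum_inner_mul_inner x x
  rw [HilbertBasis.coe_mk] at h
  have h2 := RCLike.hasSum_re 𝕜 h
  rw [inner_self_eq_norm_sq] at h2
  have h3 : (fun k => ‖inner 𝕜 (b k) x‖ ^ 2) =
      fun k => RCLike.re (inner 𝕜 x (b k) * inner 𝕜 (b k) x) := by
    funext k
    rw [← inner_conj_symm x (b k), RCLike.conj_mul]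
    norm_cast
  rw [h3]
  exact h2

/-- The family `Λᵢ* bᵢₖ` is a frame if `Λ` is a g-frame and the `bᵢ` are orthonormal bases. -/
theorem IsGFrame.isFrame_inducedFrame [CompleteSpace H] [∀ i, CompleteSpace (K i)]
    {Λ : ∀ i, H →L[𝕜] K i} (hΛ : IsGFrame Λ) {b : ∀ i, ℕ → K i}
    (hb : ∀ i, Orthonormal 𝕜 (b i))
    (hd : ∀ i, Dense (Submodule.span 𝕜 (Set.range (b i)) : Set (K i))) :
    IsFrame 𝕜 (inducedFrame Λ b) := by
  obtain ⟨A, B, hA, hAB, h⟩ := hΛ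
  refine ⟨A, B, hA, hA.trans_le hAB, fun f => ?_⟩
  obtain ⟨h1, h2, h3⟩ := h f
  have hi : ∀ i, HasSum (fun k => ‖inner 𝕜 (b i k) (Λ i f)‖ ^ 2) (‖Λ i f‖ ^ 2) :=
    fun i => hasSum_sq_inner (hb i) (hd i) _
  have hs : Summable (fun z : ℕ × ℕ => ‖inner 𝕜 (b z.1 z.2) (Λ z.1 f)‖ ^ 2) := by
    rw [summable_prod_of_nonneg (fun z => by positivity)]
    exact ⟨fun i => (hi i).summable, by simpa only [(hi _).tsum_eq] using h1⟩
  have hz : HasSum (fun z : ℕ × ℕ => ‖inner 𝕜 (b z.1 z.2) (Λ z.1 f)‖ ^ 2)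
      (∑' i, ‖Λ i f‖ ^ 2) := by
    have h4 := hs.hasSum
    rwa [(h4.prod_fiberwise hi).tsum_eq]
  have hn : HasSum (fun n => ‖inner 𝕜 (inducedFrame Λ b n) f‖ ^ 2) (∑' i, ‖Λ i f‖ ^ 2) := by
    rw [← Nat.pairEquiv.symm.hasSum_iff] at hz
    simpa [Function.comp_def, inducedFrame, ContinuousLinearMap.adjoint_inner_left] using hz
  rw [hn.tsum_eq]
  exact ⟨hn.summable, h2, h3⟩

/-! ### Representations of the `l²`-direct sum -/

/-- The orthonormal basis `Eᵢⱼ` of the direct sum: `bᵢⱼ` in the coordinate `i`, and `0` in the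
others; written as a sequence through the pairing of natural numbers. -/
def sumBasis (b : ∀ i, ℕ → K i) (n : ℕ) : lp K 2 :=
  lp.single 2 n.unpair.1 (b n.unpair.1 n.unpair.2)

variable (𝕜) in
/-- The Fourier representation of the direct sum: a name of `(fᵢ)ᵢ` consists of a name of the
double sequence `((⟨fᵢ, bᵢⱼ⟩)ⱼ)ᵢ` and of a name of the real number `∑ᵢ ‖fᵢ‖²`. -/
def fourierRep (b : ∀ i, ℕ → K i) : Rep (lp K 2) :=
  fun r f => seqRep (seqRep (scalarRep 𝕜)) (left r) (fun i j => inner 𝕜 (b i j) (f i)) ∧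
    realRep (right r) (∑' i, ‖f i‖ ^ 2)

variable (𝕜) in
/-- The coordinatewise representation of the direct sum: a name of `(fᵢ)ᵢ` consists of
`⟨p₀, p₁, …⟩` with `pᵢ` a Cauchy name of `fᵢ`, and of a name of the real number `∑ᵢ ‖fᵢ‖²`. -/
def sumRep (e : ∀ i, ℕ → K i) : Rep (lp K 2) :=
  fun r f => (∀ i, normedRep 𝕜 (e i) (component (left r) i) (f i)) ∧
    realRep (right r) (∑' i, ‖f i‖ ^ 2)

end Scalars

end TTE

end

open TTE

/-!
The hypothesis on the frame `Λᵢ* bᵢₖ` provides a name of the sequence of frame coefficients of `f`.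
Apart from the coordinates `Λᵢ f`, which are computed from the names of the `Λᵢ`, everything that a
name of `(Λᵢ f)ᵢ` consists of is read off from it.

Since the vectors `Eᵢⱼ` form an orthonormal basis of the direct sum, taking coordinates is an
isometry `U` onto `l²` (`sumIsometry`). It maps the rational combination number `n` of the `Eᵢⱼ` to
the rational combination number `n` of the unit vectors, and it maps `(Λᵢ f)ᵢ` to
`(⟨f, Λᵢ* bᵢₖ⟩)ᵢₖ`. Hence a sequence is a Cauchy name of `(Λᵢ f)ᵢ` if and only if it is a Cauchy name
of the coefficient sequence (`normedRep_sumBasis_iff`), and the realizer of the frame analysis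
operator is also a realizer for the Cauchy representation of the direct sum.

From a Cauchy name of `x ∈ l²` one obtains names of its coordinates, because they are
`1`-Lipschitz and because the coordinates of a rational point are entries of the list that it is
numbered by (`scalarRep_coordNum`). One also obtains a name of `‖x‖²`, because the squared norm of a
rational point is a rational number that is computed exactly from its number, and because the first
member of the name yields a modulus of continuity (`realRep_norm_sq`). For `x = U (Λᵢ f)ᵢ` the
coordinates are the Fourier coefficients `⟨Λᵢ f, bᵢⱼ⟩`, and `‖x‖² = ∑ᵢ ‖Λᵢ f‖²`. The coordinates
`Λᵢ f` themselves are computed by looking up the input in the tables of the `Λᵢ`, which are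
computable uniformly in `i` (`approximates_evalApprox`).

Word functions are not written down directly. A computable function `χ` that announces the symbols
of the output in any order, each of them as soon as some prefix of the input determines it, is enough
(`computableMap_of_approximates`); it need not be monotone in the input word.
-/

namespace TTE

/-! ### Prefixes of infinite sequences -/

@[simp] theorem length_pre (p : ℕ → ℕ) (n : ℕ) : (pre p n).length = n := by simp [pre]

theorem getElem?_pre (p : ℕ → ℕ) {n m : ℕ} (h : m < n) : (pre p n)[m]? = some (p m) := by
  simp [pre, h]

theorem take_pre (p : ℕ → ℕ) (a n : ℕ) : (pre p n).take a = pre p (min a n) := by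
  rw [pre, pre, ← List.map_take, List.take_range]

theorem pre_congr {p q : ℕ → ℕ} {n : ℕ} (h : ∀ m < n, p m = q m) : pre p n = pre q n := by
  simp only [pre]
  exact List.map_congr_left fun m hm => h m (List.mem_range.1 hm)

theorem pre_prefix (p : ℕ → ℕ) {m n : ℕ} (h : m ≤ n) : pre p m <+: pre p n := by
  rw [← min_eq_left h, ← take_pre]
  exact List.take_prefix _ _

theorem primrec_pre {α : Type*} [Primcodable α] {F : α → ℕ → ℕ} {n : α → ℕ} (hF : Primrec₂ F)
    (hn : Primrec n) : Primrec fun a => pre (F a) (n a) :=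
  Primrec.list_map (Primrec.list_range.comp hn) hF

/-! ### Computable maps from approximators -/

/-- The approximator `χ`, applied to prefixes of `p`, yields the sequence `r`: every symbol of `r`
is announced after finitely many symbols of `p` have been read, and no wrong symbol is ever
announced. An announced symbol may be absent again on a longer prefix. -/
def Approximates (χ : List ℕ → ℕ → Option ℕ) (p r : ℕ → ℕ) : Prop :=
  ∀ m, (∃ n, χ (pre p n) m = some (r m)) ∧ ∀ n v, χ (pre p n) m = some v → v = r m

/-- The first answer that `χ` gives for the symbol number `m` on the prefixes of `w` of length
less than `k`. -/
def firstAnswer (χ : List ℕ → ℕ → Option ℕ) (w : List ℕ) (m k : ℕ) : Option ℕ :=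
  Nat.rec none (fun n o => o <|> χ (w.take n) m) k

theorem firstAnswer_succ (χ : List ℕ → ℕ → Option ℕ) (w : List ℕ) (m k : ℕ) :
    firstAnswer χ w m (k + 1) = (firstAnswer χ w m k <|> χ (w.take k) m) := rfl

theorem firstAnswer_mono (χ : List ℕ → ℕ → Option ℕ) (w : List ℕ) (m : ℕ) {k k' v : ℕ}
    (hk : k ≤ k') (h : firstAnswer χ w m k = some v) : firstAnswer χ w m k' = some v := by
  induction k', hk using Nat.le_induction with
  | base => exact h
  | succ n _ ih => rw [firstAnswer_succ, ih]; rfl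

theorem firstAnswer_eq_of_prefix (χ : List ℕ → ℕ → Option ℕ) {w w' : List ℕ} (hw : w <+: w')
    (m : ℕ) {k : ℕ} (hk : k ≤ w.length + 1) : firstAnswer χ w m k = firstAnswer χ w' m k := by
  induction k with
  | zero => rfl
  | succ k ih =>
    rw [firstAnswer_succ, firstAnswer_succ, ih (by omega)]
    obtain ⟨t, rfl⟩ := hw
    rw [List.take_append_of_le_length (by omega)]

/-- The output symbol number `m` after the word `w` has been read, if it is known; unlike the
values of `χ`, it persists when the word is extended. -/
def answer (χ : List ℕ → ℕ → Option ℕ) (w : List ℕ) (m : ℕ) : Option ℕ :=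
  firstAnswer χ w m (w.length + 1)

theorem answer_mono (χ : List ℕ → ℕ → Option ℕ) {w w' : List ℕ} (hw : w <+: w') {m v : ℕ}
    (h : answer χ w m = some v) : answer χ w' m = some v := by
  rw [answer, firstAnswer_eq_of_prefix χ hw m le_rfl] at h
  exact firstAnswer_mono χ w' m (by have := hw.length_le; omega) h

theorem computable_answer {χ : List ℕ → ℕ → Option ℕ} (hχ : Computable₂ χ) :
    Computable₂ (answer χ) := by
  have hstep : Computable₂ fun (a : List ℕ × ℕ) (b : ℕ × Option ℕ) =>
      (b.2 <|> χ (a.1.take b.1) a.2) :=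
    Primrec.option_orElse.to_comp.comp (Computable.snd.comp Computable.snd)
      (hχ.comp (Primrec.list_take.to_comp.comp (Computable.fst.comp Computable.snd)
        (Computable.fst.comp Computable.fst)) (Computable.snd.comp Computable.fst))
  exact Computable.nat_rec (Primrec.succ.to_comp.comp (Computable.list_length.comp Computable.fst))
    (Computable.const none) hstep

theorem exists_of_firstAnswer {χ : List ℕ → ℕ → Option ℕ} {w : List ℕ} {m k v : ℕ}
    (h : firstAnswer χ w m k = some v) : ∃ n < k, χ (w.take n) m = some v := by
  induction k with
  | zero => cases h
  | succ k ih =>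
    rw [firstAnswer_succ] at h
    cases ho : firstAnswer χ w m k with
    | some v' =>
      rw [ho] at h
      obtain ⟨n, hn, h'⟩ := ih (by rw [ho]; exact h)
      exact ⟨n, by omega, h'⟩
    | none =>
      rw [ho] at h
      exact ⟨k, by omega, by simpa using h⟩

theorem Approximates.answer_eq {χ : List ℕ → ℕ → Option ℕ} {p r : ℕ → ℕ}
    (h : Approximates χ p r) {n m v : ℕ} (hv : answer χ (pre p n) m = some v) : v = r m := by
  obtain ⟨k, -, hk⟩ := exists_of_firstAnswer hv
  rw [take_pre] at hk
  exact (h m).2 _ _ hk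

theorem Approximates.exists_answer {χ : List ℕ → ℕ → Option ℕ} {p r : ℕ → ℕ}
    (h : Approximates χ p r) (m : ℕ) : ∃ n, answer χ (pre p n) m = some (r m) := by
  obtain ⟨n, hn⟩ := (h m).1
  refine ⟨n, ?_⟩
  have h1 : ∃ v, answer χ (pre p n) m = some v := by
    rw [answer, length_pre, firstAnswer_succ, take_pre, min_self, hn]
    cases firstAnswer χ (pre p n) m n <;> exact ⟨_, rfl⟩
  obtain ⟨v, hv⟩ := h1
  rw [hv, h.answer_eq hv]

/-- The word that is obtained from the empty word by `k` attempts to append the next symbol of `φ`;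
an attempt fails if this symbol is `none`. -/
def emit (φ : ℕ → Option ℕ) (k : ℕ) : List ℕ :=
  Nat.rec [] (fun _ l => ((φ l.length).map fun v => l ++ [v]).getD l) k

theorem emit_succ_of_none {φ : ℕ → Option ℕ} {k : ℕ} (h : φ (emit φ k).length = none) :
    emit φ (k + 1) = emit φ k := by
  change ((φ (emit φ k).length).map _).getD _ = _
  rw [h]; rfl

theorem emit_succ_of_some {φ : ℕ → Option ℕ} {k v : ℕ} (h : φ (emit φ k).length = some v) :
    emit φ (k + 1) = emit φ k ++ [v] := by
  change ((φ (emit φ k).length).map _).getD _ = _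
  rw [h]; rfl

theorem length_emit_le (φ : ℕ → Option ℕ) (k : ℕ) : (emit φ k).length ≤ k := by
  induction k with
  | zero => exact le_rfl
  | succ k ih =>
    cases h : φ (emit φ k).length with
    | none => rw [emit_succ_of_none h]; omega
    | some v => rw [emit_succ_of_some h]; simpa using ih

theorem getElem?_emit (φ : ℕ → Option ℕ) (k : ℕ) {m : ℕ} (hm : m < (emit φ k).length) :
    (emit φ k)[m]? = φ m := by
  induction k with
  | zero => simp [emit] at hm
  | succ k ih =>
    cases h : φ (emit φ k).length with
    | none => rw [emit_succ_of_none h] at hm ⊢; exact ih hm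
    | some v =>
      rw [emit_succ_of_some h] at hm ⊢
      rcases (Nat.lt_succ_iff_lt_or_eq.1 (by simpa using hm)) with h' | rfl
      · rw [List.getElem?_append_left h', ih h']
      · simp [h]

theorem le_length_emit {φ : ℕ → Option ℕ} {N k : ℕ} (h : ∀ m < N, (φ m).isSome) (hk : N ≤ k) :
    N ≤ (emit φ k).length := by
  have key : ∀ k, min N k ≤ (emit φ k).length := by
    intro k
    induction k with
    | zero => simp
    | succ k ih =>
      by_cases hN : N ≤ (emit φ k).length
      · refine (min_le_left _ _).trans (hN.trans ?_)
        cases h' : φ (emit φ k).length with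
        | none => rw [emit_succ_of_none h']
        | some v => rw [emit_succ_of_some h']; simp
      · obtain ⟨v, hv⟩ := Option.isSome_iff_exists.1 (h _ (not_le.1 hN))
        rw [emit_succ_of_some hv]
        simp only [List.length_append, List.length_singleton]
        omega
  simpa [hk] using key k

theorem emit_prefix {φ ψ : ℕ → Option ℕ} (h : ∀ m v, φ m = some v → ψ m = some v) {k k' : ℕ}
    (hk : k ≤ k') : emit φ k <+: emit ψ k' := by
  have hs : ∀ m (hm : m < (emit φ k).length), ψ m = some (emit φ k)[m] := fun m hm =>
    h m _ (by rw [← getElem?_emit φ k hm, List.getElem?_eq_getElem hm])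
  have hlen : (emit φ k).length ≤ (emit ψ k').length :=
    le_length_emit (fun m hm => by rw [hs m hm]; rfl) ((length_emit_le φ k).trans hk)
  rw [List.prefix_iff_getElem?]
  intro m hm
  rw [getElem?_emit ψ k' (hm.trans_le hlen), hs m hm]

/-- The word function that writes the answers of `χ` in their order, as far as they are known. -/
def wordFun (χ : List ℕ → ℕ → Option ℕ) (w : List ℕ) : List ℕ := emit (answer χ w) w.length

theorem monotoneWord_wordFun (χ : List ℕ → ℕ → Option ℕ) : MonotoneWord (wordFun χ) :=
  fun _ _ hw => emit_prefix (fun _ _ => answer_mono χ hw) hw.length_le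

theorem computable_wordFun {χ : List ℕ → ℕ → Option ℕ} (hχ : Computable₂ χ) :
    Computable (wordFun χ) := by
  have hl : Computable fun a : List ℕ × (ℕ × List ℕ) => a.2.2 :=
    Computable.snd.comp Computable.snd
  have hstep : Computable₂ fun (w : List ℕ) (b : ℕ × List ℕ) =>
      ((answer χ w b.2.length).map fun v => b.2 ++ [v]).getD b.2 :=
    Computable.option_getD
      (Computable.option_map
        ((computable_answer hχ).comp Computable.fst (Computable.list_length.comp hl))
        (Computable.list_concat.comp (hl.comp Computable.fst) Computable.snd)) hl
  exact Computable.nat_rec Computable.list_length (Computable.const []) hstep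

theorem Approximates.outputs_wordFun {χ : List ℕ → ℕ → Option ℕ} {p r : ℕ → ℕ}
    (h : Approximates χ p r) : Outputs (wordFun χ) p r := by
  refine ⟨fun n => ?_, fun N => ?_⟩
  · refine List.ext_getElem? fun m => ?_
    rcases lt_or_ge m (wordFun χ (pre p n)).length with hm | hm
    · have h1 : (wordFun χ (pre p n))[m]? = answer χ (pre p n) m := getElem?_emit _ _ hm
      have h2 := List.getElem?_eq_getElem hm
      rw [getElem?_pre r hm, h2, h.answer_eq (h1.symm.trans h2)]
    · rw [List.getElem?_eq_none hm, List.getElem?_eq_none (by simpa using hm)]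
  · choose k hk using h.exists_answer
    refine ⟨N + ∑ m ∈ Finset.range N, k m, le_length_emit (fun m hm => ?_) (by simp)⟩
    have hle : k m ≤ N + ∑ m ∈ Finset.range N, k m :=
      (Finset.single_le_sum (fun _ _ => Nat.zero_le _) (Finset.mem_range.2 hm)).trans
        (Nat.le_add_left _ _)
    rw [answer_mono χ (pre_prefix p hle) (hk m)]
    rfl

/-- A map is computable if a computable approximator announces the symbols of a name of its
values. -/
theorem computableMap_of_approximates {X Y : Type*} {δ : Rep X} {δ' : Rep Y} {f : X → Y}
    {χ : List ℕ → ℕ → Option ℕ} (hχ : Computable₂ χ)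
    (h : ∀ p x, δ p x → ∃ r, Approximates χ p r ∧ δ' r (f x)) : ComputableMap δ δ' f := by
  refine ⟨wordFun χ, computable_wordFun hχ, monotoneWord_wordFun χ, fun p x hp => ?_⟩
  obtain ⟨r, hr, hr'⟩ := h p x hp
  exact ⟨r, hr.outputs_wordFun, hr'⟩

/-! ### Operations on approximators -/

/-- The pair `⟨p, q⟩` of two sequences. -/
def interleave (p q : ℕ → ℕ) (n : ℕ) : ℕ := bif n.bodd then q n.div2 else p n.div2

@[simp] theorem left_interleave (p q : ℕ → ℕ) : left (interleave p q) = p := by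
  funext n
  simp [left, interleave, Nat.bodd_mul, Nat.div2_val]

@[simp] theorem right_interleave (p q : ℕ → ℕ) : right (interleave p q) = q := by
  funext n
  simp [right, interleave, Nat.bodd_mul, Nat.div2_val]

/-- The approximator of a pair of sequences. -/
def pairApprox (χ χ' : List ℕ → ℕ → Option ℕ) (w : List ℕ) (m : ℕ) : Option ℕ :=
  bif m.bodd then χ' w m.div2 else χ w m.div2

theorem computable_pairApprox {χ χ' : List ℕ → ℕ → Option ℕ} (h : Computable₂ χ)
    (h' : Computable₂ χ') : Computable₂ (pairApprox χ χ') :=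
  Computable.cond (Computable.nat_bodd.comp Computable.snd)
    (h'.comp Computable.fst (Computable.nat_div2.comp Computable.snd))
    (h.comp Computable.fst (Computable.nat_div2.comp Computable.snd))

theorem Approximates.pair {χ χ' : List ℕ → ℕ → Option ℕ} {p r r' : ℕ → ℕ}
    (h : Approximates χ p r) (h' : Approximates χ' p r') :
    Approximates (pairApprox χ χ') p (interleave r r') := by
  intro m
  simp only [pairApprox, interleave]
  cases m.bodd
  · exact h _
  · exact h' _

/-- The approximator that applies `χ` to the output of the word function `g`. The length of the
input word encodes which prefix of the input is given to `g`, and which prefix of the output of `g`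
is given to `χ`; so all combinations are tried. -/
def compApprox (χ : List ℕ → ℕ → Option ℕ) (g : List ℕ → List ℕ) (w : List ℕ) (m : ℕ) :
    Option ℕ :=
  χ ((g (w.take w.length.unpair.1)).take w.length.unpair.2) m

theorem computable_compApprox {χ : List ℕ → ℕ → Option ℕ} {g : List ℕ → List ℕ}
    (hχ : Computable₂ χ) (hg : Computable g) : Computable₂ (compApprox χ g) := by
  have hu : Computable fun a : List ℕ × ℕ => a.1.length.unpair :=
    Computable.unpair.comp (Computable.list_length.comp Computable.fst)
  exact hχ.comp (Primrec.list_take.to_comp.comp (Computable.snd.comp hu)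
    (hg.comp (Primrec.list_take.to_comp.comp (Computable.fst.comp hu) Computable.fst)))
    Computable.snd

theorem take_pre_pair (p : ℕ → ℕ) (a b : ℕ) : (pre p (Nat.pair a b)).take a = pre p a := by
  rw [take_pre, min_eq_left (Nat.left_le_pair a b)]

theorem Approximates.comp {χ : List ℕ → ℕ → Option ℕ} {g : List ℕ → List ℕ} {p s r : ℕ → ℕ}
    (hg : Outputs g p s) (h : Approximates χ s r) : Approximates (compApprox χ g) p r := by
  intro m
  obtain ⟨⟨b, hb⟩, h2⟩ := h m
  refine ⟨?_, fun n v hv => ?_⟩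
  · obtain ⟨a, ha⟩ := hg.2 b
    refine ⟨Nat.pair a b, ?_⟩
    rw [compApprox, length_pre, Nat.unpair_pair, take_pre_pair, hg.1 a, take_pre, min_eq_left ha,
      hb]
  · rw [compApprox, take_pre, hg.1, take_pre] at hv
    exact h2 _ _ hv

/-! ### Evaluation of a uniformly computable sequence of functions -/

/-- Given a word function `g` that computes from `i` a name of a function `Fᵢ`, this approximator
announces the symbols of a name of `⟨F₀ x, F₁ x, …⟩` when a name of `x` is read. The length of the
word encodes the length `a` of a prefix of the input and the length `b` of a prefix of the name
`i, i, i, …` of `i`. From the latter, `g` computes a part of the name of `Fᵢ`, which is the right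
half of a pair and a table; the symbol is taken from the entry of this table for the prefix of
length `a`, if both are long enough. -/
def evalApprox (g : List ℕ → List ℕ) (w : List ℕ) (m : ℕ) : Option ℕ :=
  ((g (pre (fun _ => m.unpair.1) w.length.unpair.2))[2 *
    Encodable.encode (w.take w.length.unpair.1) + 1]?).bind fun c =>
      (Denumerable.ofNat (List ℕ) c)[m.unpair.2]?

theorem computable_evalApprox {g : List ℕ → List ℕ} (hg : Computable g) :
    Computable₂ (evalApprox g) := by
  have hu : Primrec fun a : List ℕ × ℕ => a.1.length.unpair :=
    Primrec.unpair.comp (Primrec.list_length.comp Primrec.fst)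
  have hm : Primrec fun a : List ℕ × ℕ => a.2.unpair := Primrec.unpair.comp Primrec.snd
  have h1 : Primrec fun a : List ℕ × ℕ => pre (fun _ => a.2.unpair.1) a.1.length.unpair.2 :=
    primrec_pre ((Primrec.fst.comp hm).comp Primrec.fst) (Primrec.snd.comp hu)
  have h2 : Primrec fun a : List ℕ × ℕ =>
      2 * Encodable.encode (a.1.take a.1.length.unpair.1) + 1 :=
    Primrec.nat_double_succ.comp
      (Primrec.encode.comp (Primrec.list_take.comp (Primrec.fst.comp hu) Primrec.fst))
  have h3 : Primrec₂ fun (a : List ℕ × ℕ) (c : ℕ) =>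
      (Denumerable.ofNat (List ℕ) c)[a.2.unpair.2]? :=
    Primrec.list_getElem?.comp ((Primrec.ofNat (List ℕ)).comp Primrec.snd)
      ((Primrec.snd.comp hm).comp Primrec.fst)
  exact Computable.option_bind
    (Computable.list_getElem?.comp (hg.comp h1.to_comp) h2.to_comp) h3.to_comp

theorem Outputs.eq_of_getElem? {g : List ℕ → List ℕ} {p r : ℕ → ℕ} (h : Outputs g p r)
    {n m v : ℕ} (hv : (g (pre p n))[m]? = some v) : v = r m := by
  have hm : m < (g (pre p n)).length := (List.getElem?_eq_some_iff.1 hv).1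
  rw [h.1 n, getElem?_pre r hm] at hv
  exact (Option.some.inj hv).symm

theorem Outputs.exists_getElem? {g : List ℕ → List ℕ} {p r : ℕ → ℕ} (h : Outputs g p r)
    (m : ℕ) : ∃ n, (g (pre p n))[m]? = some (r m) := by
  obtain ⟨n, hn⟩ := h.2 (m + 1)
  exact ⟨n, by rw [h.1 n, getElem?_pre r hn]⟩

theorem approximates_evalApprox {g : List ℕ → List ℕ} {p : ℕ → ℕ} {R y : ℕ → ℕ → ℕ}
    (hg : ∀ i, Outputs g (fun _ => i) (R i))
    (hy : ∀ i, Outputs (table (right (R i))) p (y i)) :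
    Approximates (evalApprox g) p fun m => y m.unpair.1 m.unpair.2 := by
  intro m
  refine ⟨?_, fun n v hv => ?_⟩
  · obtain ⟨a, ha⟩ := (hy m.unpair.1).exists_getElem? m.unpair.2
    obtain ⟨b, hb⟩ := (hg m.unpair.1).exists_getElem? (2 * Encodable.encode (pre p a) + 1)
    refine ⟨Nat.pair a b, ?_⟩
    rw [evalApprox, length_pre, Nat.unpair_pair, take_pre_pair, hb]
    exact ha
  · rw [evalApprox, Option.bind_eq_some_iff] at hv
    obtain ⟨c, hc, hv⟩ := hv
    rw [(hg _).eq_of_getElem? hc, length_pre, take_pre] at hv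
    exact (hy m.unpair.1).eq_of_getElem? hv

/-! ### Names of sequences -/

/-- A name of a sequence of points in the function space representation, built from names `x i` of
the points: the table of the word function that maps a word `i :: w` to the prefix of `x i` of the
same length. -/
def seqName (x : ℕ → ℕ → ℕ) (m : ℕ) : ℕ :=
  Encodable.encode (pre (x (Denumerable.ofNat (List ℕ) m).headI)
    (Denumerable.ofNat (List ℕ) m).length)

theorem table_seqName (x : ℕ → ℕ → ℕ) (w : List ℕ) :
    table (seqName x) w = pre (x w.headI) w.length := by
  simp [table, seqName]

theorem seqRep_seqName {X : Type*} {δ : Rep X} {x : ℕ → ℕ → ℕ} {f : ℕ → X}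
    (h : ∀ i, δ (x i) (f i)) : seqRep δ (seqName x) f := by
  refine ⟨fun w w' hw => ?_, fun p i hp => ⟨x i, ⟨fun n => ?_, fun N => ⟨N, ?_⟩⟩, h i⟩⟩
  · rw [table_seqName, table_seqName]
    cases w with
    | nil => exact List.nil_prefix
    | cons i w =>
      obtain ⟨t, rfl⟩ := hw
      exact pre_prefix _ (by simp)
  · rw [table_seqName, length_pre, length_pre]
    cases n with
    | zero => rfl
    | succ n =>
      have : (pre p (n + 1)).headI = i := by
        rw [← (show p 0 = i from hp)]
        simp [pre, List.range_succ_eq_map]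
      rw [this]
  · rw [table_seqName, length_pre, length_pre]

/-- The symbol number `m` of the name of a sequence depends only on the first `m` symbols of the
names of its members, because a word is not longer than its number. -/
theorem seqName_congr {x y : ℕ → ℕ → ℕ} {m : ℕ} (h : ∀ i, ∀ t < m, x i t = y i t) :
    seqName x m = seqName y m := by
  have hm : (Denumerable.ofNat (List ℕ) m).length ≤ m := by
    simpa using Encodable.length_le_encode (Denumerable.ofNat (List ℕ) m)
  rw [seqName, seqName, pre_congr fun t ht => h _ t (ht.trans_le hm)]

theorem primrec_seqName {α : Type*} [Primcodable α] {F : α → ℕ → ℕ → ℕ}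
    (hF : Primrec fun q : α × ℕ × ℕ => F q.1 q.2.1 q.2.2) :
    Primrec₂ fun a m => seqName (F a) m := by
  have hw : Primrec fun q : α × ℕ => Denumerable.ofNat (List ℕ) q.2 :=
    (Primrec.ofNat (List ℕ)).comp Primrec.snd
  have h1 : Primrec₂ fun (q : α × ℕ) (t : ℕ) => F q.1 (Denumerable.ofNat (List ℕ) q.2).headI t :=
    hF.comp (Primrec.pair (Primrec.fst.comp Primrec.fst)
      (Primrec.pair (Primrec.list_headI.comp (hw.comp Primrec.fst)) Primrec.snd))
  exact Primrec.encode.comp (primrec_pre h1 (Primrec.list_length.comp hw))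

/-! ### Rational arithmetic on numbers of rationals -/

/-- A number of the sum of two rationals. -/
def ratAdd (m n : ℕ) : ℕ :=
  Nat.pair (m.unpair.1 * (n.unpair.2.unpair.2 + 1) + n.unpair.1 * (m.unpair.2.unpair.2 + 1))
    (Nat.pair
      (m.unpair.2.unpair.1 * (n.unpair.2.unpair.2 + 1) +
        n.unpair.2.unpair.1 * (m.unpair.2.unpair.2 + 1))
      (m.unpair.2.unpair.2 * n.unpair.2.unpair.2 + m.unpair.2.unpair.2 + n.unpair.2.unpair.2))

/-- A number of the square of a rational. -/
def ratSq (n : ℕ) : ℕ :=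
  Nat.pair (n.unpair.1 * n.unpair.1 + n.unpair.2.unpair.1 * n.unpair.2.unpair.1)
    (Nat.pair (2 * (n.unpair.1 * n.unpair.2.unpair.1))
      (n.unpair.2.unpair.2 * n.unpair.2.unpair.2 + 2 * n.unpair.2.unpair.2))

theorem ratNum_ratAdd (m n : ℕ) : ratNum (ratAdd m n) = ratNum m + ratNum n := by
  simp only [ratNum, ratAdd, Nat.unpair_pair]
  rw [div_add_div _ _ (by positivity) (by positivity)]
  push_cast
  congr 1 <;> ring

theorem ratNum_ratSq (n : ℕ) : ratNum (ratSq n) = ratNum n ^ 2 := by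
  simp only [ratNum, ratSq, Nat.unpair_pair]
  rw [div_pow]
  push_cast
  congr 1 <;> ring

theorem ratNum_zero : ratNum 0 = 0 := by simp [ratNum]

theorem ratNum_le (n : ℕ) : ratNum n ≤ n.unpair.1 := by
  rw [ratNum, div_le_iff₀ (by positivity)]
  have h1 : (0 : ℝ) ≤ n.unpair.1 := by positivity
  have h2 : (0 : ℝ) ≤ n.unpair.2.unpair.1 := by positivity
  have h3 : (0 : ℝ) ≤ n.unpair.2.unpair.2 := by positivity
  nlinarith [mul_nonneg h1 h3]

theorem primrec_ratAdd : Primrec₂ ratAdd := by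
  have hp : ∀ {f g : ℕ × ℕ → ℕ}, Primrec f → Primrec g → Primrec fun a => f a * g a :=
    fun hf hg => Primrec.nat_mul.comp hf hg
  have ha : ∀ {f g : ℕ × ℕ → ℕ}, Primrec f → Primrec g → Primrec fun a => f a + g a :=
    fun hf hg => Primrec.nat_add.comp hf hg
  have hm := Primrec.unpair.comp (Primrec.fst (α := ℕ) (β := ℕ))
  have hn := Primrec.unpair.comp (Primrec.snd (α := ℕ) (β := ℕ))
  have hm2 := Primrec.unpair.comp (Primrec.snd.comp hm)
  have hn2 := Primrec.unpair.comp (Primrec.snd.comp hn)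
  have hmc := Primrec.snd.comp hm2
  have hnc := Primrec.snd.comp hn2
  have hmc1 := Primrec.succ.comp hmc
  have hnc1 := Primrec.succ.comp hnc
  exact Primrec₂.natPair.comp
    (ha (hp (Primrec.fst.comp hm) hnc1) (hp (Primrec.fst.comp hn) hmc1))
    (Primrec₂.natPair.comp
      (ha (hp (Primrec.fst.comp hm2) hnc1) (hp (Primrec.fst.comp hn2) hmc1))
      (ha (ha (hp hmc hnc) hmc) hnc))

theorem primrec_ratSq : Primrec ratSq := by
  have hn := Primrec.unpair
  have hn2 := Primrec.unpair.comp (Primrec.snd.comp hn)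
  have h1 := Primrec.fst.comp hn
  have h2 := Primrec.fst.comp hn2
  have h3 := Primrec.snd.comp hn2
  exact Primrec₂.natPair.comp
    (Primrec.nat_add.comp (Primrec.nat_mul.comp h1 h1) (Primrec.nat_mul.comp h2 h2))
    (Primrec₂.natPair.comp (Primrec.nat_double.comp (Primrec.nat_mul.comp h1 h2))
      (Primrec.nat_add.comp (Primrec.nat_mul.comp h3 h3) (Primrec.nat_double.comp h3)))

section Scalars

variable (𝕜 : Type*) [RCLike 𝕜]

theorem scalarNum_zero : scalarNum 𝕜 0 = 0 := by simp [scalarNum, ratNum_zero]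

/-- The program depends on the field: in the real case, where `RCLike.I = 0`, the second component
of a number is discarded. -/
theorem exists_primrec_norm_scalarNum_sq :
    ∃ N : ℕ → ℕ, Primrec N ∧ ∀ n, ratNum (N n) = ‖scalarNum 𝕜 n‖ ^ 2 := by
  have h1 : Primrec fun n : ℕ => ratSq n.unpair.1 :=
    primrec_ratSq.comp (Primrec.fst.comp Primrec.unpair)
  have h2 : Primrec fun n : ℕ => ratSq n.unpair.2 :=
    primrec_ratSq.comp (Primrec.snd.comp Primrec.unpair)
  rcases RCLike.I_eq_zero_or_im_I_eq_one (K := 𝕜) with hI | hI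
  · refine ⟨_, h1, fun n => ?_⟩
    rw [ratNum_ratSq, scalarNum, hI, mul_zero, add_zero, RCLike.norm_ofReal, sq_abs]
  · refine ⟨_, primrec_ratAdd.comp h1 h2, fun n => ?_⟩
    rw [ratNum_ratAdd, ratNum_ratSq, ratNum_ratSq, RCLike.norm_sq_eq_def]
    simp [scalarNum, hI, sq]

/-! ### Rational points of `l²` -/

/-- The number of a scalar that is the coordinate `k` of the rational point number `n` of `l²`. -/
def coordNum (n k : ℕ) : ℕ := (Denumerable.ofNat (List ℕ) n).getD k 0

theorem primrec_coordNum : Primrec₂ coordNum :=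
  (Primrec.list_getD 0).comp ((Primrec.ofNat (List ℕ)).comp Primrec.fst) Primrec.snd

theorem comboNum_unitVec_apply (n k : ℕ) :
    comboNum 𝕜 (unitVec 𝕜) n k = scalarNum 𝕜 (coordNum n k) := by
  rw [comboNum, lp.coeFn_sum, Finset.sum_apply, coordNum]
  generalize Denumerable.ofNat (List ℕ) n = l
  by_cases hk : k < l.length
  · rw [Finset.sum_eq_single (⟨k, hk⟩ : Fin l.length)]
    · simp [unitVec, List.getD_eq_getElem?_getD, hk]
    · intro i _ hi
      have : k ≠ i := fun h => hi (Fin.ext h.symm)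
      simp [unitVec, this]
    · simp
  · rw [Finset.sum_eq_zero fun i _ => ?_]
    · simp [List.getD_eq_getElem?_getD, not_lt.1 hk, scalarNum_zero]
    · have : k ≠ i := fun h => hk (h ▸ i.2)
      simp [unitVec, this]

theorem norm_sq_eq_tsum {E : ℕ → Type*} [∀ i, NormedAddCommGroup (E i)] (x : lp E 2) :
    ‖x‖ ^ 2 = ∑' i, ‖x i‖ ^ 2 := by
  have h := lp.norm_rpow_eq_tsum (p := 2) (by simp) x
  simpa using h

theorem norm_comboNum_unitVec_sq (n : ℕ) : ‖comboNum 𝕜 (unitVec 𝕜) n‖ ^ 2 =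
    ((Denumerable.ofNat (List ℕ) n).map fun a => ‖scalarNum 𝕜 a‖ ^ 2).sum := by
  rw [norm_sq_eq_tsum]
  simp only [comboNum_unitVec_apply, coordNum]
  generalize Denumerable.ofNat (List ℕ) n = l
  rw [tsum_eq_sum (s := Finset.range l.length), Finset.sum_range,
    ← Fin.sum_univ_fun_getElem]
  · simp
  · intro k hk
    simp [List.getD_eq_getElem?_getD, not_lt.1 (mt Finset.mem_range.2 hk), scalarNum_zero]

theorem exists_primrec_norm_comboNum_sq :
    ∃ N : ℕ → ℕ, Primrec N ∧ ∀ n, ratNum (N n) = ‖comboNum 𝕜 (unitVec 𝕜) n‖ ^ 2 := by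
  obtain ⟨N, hN, h⟩ := exists_primrec_norm_scalarNum_sq 𝕜
  have hstep : Primrec₂ fun (_ : ℕ) (q : ℕ × ℕ) => ratAdd (N q.1) q.2 :=
    primrec_ratAdd.comp (hN.comp (Primrec.fst.comp Primrec.snd)) (Primrec.snd.comp Primrec.snd)
  have hfold := Primrec.list_foldr (Primrec.ofNat (List ℕ)) (Primrec.const 0) hstep
  refine ⟨_, hfold, fun n => ?_⟩
  rw [norm_comboNum_unitVec_sq]
  generalize Denumerable.ofNat (List ℕ) n = l
  induction l with
  | nil => rw [List.foldr_nil, List.map_nil, List.sum_nil, ratNum_zero]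
  | cons a l ih => rw [List.foldr_cons, ratNum_ratAdd, ih, h, List.map_cons, List.sum_cons]

/-! ### Coordinates and norms of points of `l²` -/

variable {𝕜}

theorem scalarRep_coordNum {s : ℕ → ℕ} {x : lp (fun _ : ℕ => 𝕜) 2}
    (hs : normedRep 𝕜 (unitVec 𝕜) s x) (k : ℕ) :
    scalarRep 𝕜 (fun t => coordNum (s t) k) (x k) := by
  have hle : ∀ y z : lp (fun _ : ℕ => 𝕜) 2, dist (y k) (z k) ≤ dist y z := fun y z => by
    rw [dist_eq_norm, dist_eq_norm]
    exact lp.norm_apply_le_norm two_ne_zero (y - z) k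
  refine ⟨fun i j hij => ?_, ?_⟩
  · simp only [← comboNum_unitVec_apply]
    exact (hle _ _).trans_lt (hs.1 i j hij)
  · simp only [← comboNum_unitVec_apply]
    rw [tendsto_iff_dist_tendsto_zero]
    exact squeeze_zero (fun _ => dist_nonneg) (fun _ => hle _ _)
      (tendsto_iff_dist_tendsto_zero.1 hs.2)

/-- The approximator of a name of the double sequence `(x ⟨i, j⟩)ᵢⱼ` of the coordinates of
`x ∈ l²`, given a name of `x`. -/
def coordApprox (u : List ℕ) (m : ℕ) : Option ℕ :=
  if m ≤ u.length then
    some (seqName (fun i => seqName fun j t => coordNum (u.getD t 0) (Nat.pair i j)) m)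
  else none

theorem computable_coordApprox : Computable₂ coordApprox := by
  have h1 : Primrec fun q : (List ℕ × ℕ) × ℕ × ℕ =>
      coordNum (q.1.1.getD q.2.2 0) (Nat.pair q.1.2 q.2.1) :=
    primrec_coordNum.comp
      ((Primrec.list_getD 0).comp (Primrec.fst.comp Primrec.fst) (Primrec.snd.comp Primrec.snd))
      (Primrec₂.natPair.comp (Primrec.snd.comp Primrec.fst) (Primrec.fst.comp Primrec.snd))
  have h2 := primrec_seqName (α := List ℕ × ℕ)
    (F := fun a j t => coordNum (a.1.getD t 0) (Nat.pair a.2 j)) h1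
  have h3 := primrec_seqName (α := List ℕ)
    (F := fun u i => seqName fun j t => coordNum (u.getD t 0) (Nat.pair i j))
    (h2.comp (Primrec.pair Primrec.fst (Primrec.fst.comp Primrec.snd))
      (Primrec.snd.comp Primrec.snd))
  exact (Primrec.ite (Primrec.nat_le.comp Primrec.snd (Primrec.list_length.comp Primrec.fst))
    (Primrec.option_some.comp h3) (Primrec.const none)).to_comp

theorem approximates_coordApprox (s : ℕ → ℕ) : Approximates coordApprox s
    (seqName fun i => seqName fun j t => coordNum (s t) (Nat.pair i j)) := by
  -- The symbol number `m` involves at most the first `m` members of the name of `x`.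
  have key : ∀ m n, m ≤ n → coordApprox (pre s n) m =
      some (seqName (fun i => seqName fun j t => coordNum (s t) (Nat.pair i j)) m) := by
    intro m n hmn
    rw [coordApprox, length_pre, if_pos hmn]
    congr 1
    refine seqName_congr fun i k hk => seqName_congr fun j t ht => ?_
    rw [List.getD_eq_getElem?_getD, getElem?_pre s (by omega), Option.getD_some]
  refine fun m => ⟨⟨m, key m m le_rfl⟩, fun n v hv => ?_⟩
  rcases le_or_gt m n with hmn | hmn
  · rw [key m n hmn] at hv
    exact (Option.some.inj hv).symm
  · rw [coordApprox, length_pre, if_neg (not_le.2 hmn)] at hv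
    cases hv

/-- A shift that is sufficient to obtain a Cauchy name of `‖x‖²` from a Cauchy name `y₀, y₁, …` of
`x`, where `a` is a number of the rational `‖y₀‖²`: it bounds `‖yᵢ‖ + ‖yⱼ‖`, because `‖y₀‖²` is at
most the first component of `a` and `‖yᵢ - y₀‖ < 1`. -/
def normShift (a : ℕ) : ℕ := 2 * (a.unpair.1 + 2)

/-- The approximator of a name of `‖x‖²`, given a name of `x ∈ l²`; here `N` computes the squared
norms of the rational points. -/
def normSqApprox (N : ℕ → ℕ) (u : List ℕ) (m : ℕ) : Option ℕ :=
  (u[0]?).bind fun a => (u[m + normShift (N a)]?).map N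

theorem computable_normSqApprox {N : ℕ → ℕ} (hN : Primrec N) : Computable₂ (normSqApprox N) := by
  have h1 : Primrec fun a => normShift (N a) :=
    Primrec.nat_double.comp (Primrec.nat_add.comp
      (Primrec.fst.comp (Primrec.unpair.comp hN)) (Primrec.const 2))
  have h2 : Primrec₂ fun (q : List ℕ × ℕ) (a : ℕ) =>
      (q.1[q.2 + normShift (N a)]?).map N :=
    Primrec.option_map (Primrec.list_getElem?.comp (Primrec.fst.comp Primrec.fst)
      (Primrec.nat_add.comp (Primrec.snd.comp Primrec.fst) (h1.comp Primrec.snd)))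
      (hN.comp Primrec.snd)
  exact (Primrec.option_bind
    (Primrec.list_getElem?.comp Primrec.fst (Primrec.const 0)) h2).to_comp

theorem approximates_normSqApprox (N : ℕ → ℕ) (s : ℕ → ℕ) :
    Approximates (normSqApprox N) s fun m => N (s (m + normShift (N (s 0)))) := by
  intro m
  refine ⟨⟨m + normShift (N (s 0)) + 1, ?_⟩, fun n v hv => ?_⟩
  · rw [normSqApprox, getElem?_pre s (by omega), Option.bind_some, getElem?_pre s (by omega),
      Option.map_some]
  · have hget : ∀ {k c}, (pre s n)[k]? = some c → c = s k := by
      intro k c hc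
      have hk : k < n := by simpa using (List.getElem?_eq_some_iff.1 hc).1
      rw [getElem?_pre s hk] at hc
      exact (Option.some.inj hc).symm
    rw [normSqApprox, Option.bind_eq_some_iff] at hv
    obtain ⟨a, ha, hv⟩ := hv
    obtain ⟨c, hc, rfl⟩ := Option.map_eq_some_iff.1 hv
    rw [hget hc, hget ha]

theorem realRep_norm_sq {N : ℕ → ℕ} (hN : ∀ n, ratNum (N n) = ‖comboNum 𝕜 (unitVec 𝕜) n‖ ^ 2)
    {s : ℕ → ℕ} {x : lp (fun _ : ℕ => 𝕜) 2} (hs : normedRep 𝕜 (unitVec 𝕜) s x) :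
    realRep (fun m => N (s (m + normShift (N (s 0))))) (‖x‖ ^ 2) := by
  obtain ⟨h1, h2⟩ := hs
  set y : ℕ → lp (fun _ : ℕ => 𝕜) 2 := fun i => comboNum 𝕜 (unitVec 𝕜) (s i) with hy
  set a := (N (s 0)).unpair.1 with ha
  have hy0 : ‖y 0‖ ≤ a + 1 := by
    have h3 : ‖y 0‖ ^ 2 ≤ a := by rw [hy, ← hN]; exact ratNum_le _
    nlinarith [sq_nonneg (‖y 0‖ - 1)]
  have hbound : ∀ i, ‖y i‖ ≤ a + 2 := by
    intro i
    rcases Nat.eq_zero_or_pos i with rfl | hi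
    · linarith
    · have h3 := h1 0 i hi
      rw [pow_zero, dist_comm, dist_eq_norm] at h3
      have h4 := norm_le_norm_add_norm_sub' (y i) (y 0)
      linarith
  have hK : ((normShift (N (s 0)) : ℕ) : ℝ) = 2 * ((a : ℝ) + 2) := by
    simp [normShift, ha]
  refine ⟨fun i j hij => ?_, ?_⟩
  · simp only [hN]
    set k := normShift (N (s 0))
    have h3 : dist (y (i + k)) (y (j + k)) < (1 / 2) ^ (i + k) := h1 _ _ (by omega)
    have h4 : |‖y (i + k)‖ - ‖y (j + k)‖| ≤ dist (y (i + k)) (y (j + k)) := by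
      rw [dist_eq_norm]; exact abs_norm_sub_norm_le _ _
    have h5 : ‖y (i + k)‖ + ‖y (j + k)‖ ≤ k := by
      rw [hK]; linarith [hbound (i + k), hbound (j + k)]
    have h6 : (k : ℝ) ≤ 2 ^ k := by exact_mod_cast Nat.lt_two_pow_self.le
    have h7 : (0 : ℝ) < k := by rw [hK]; positivity
    rw [Real.dist_eq, sq_sub_sq, abs_mul, abs_of_nonneg (by positivity)]
    calc (‖y (i + k)‖ + ‖y (j + k)‖) * |‖y (i + k)‖ - ‖y (j + k)‖|
        ≤ k * dist (y (i + k)) (y (j + k)) := mul_le_mul h5 h4 (abs_nonneg _) h7.le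
      _ < k * (1 / 2) ^ (i + k) := mul_lt_mul_of_pos_left h3 h7
      _ ≤ 2 ^ k * (1 / 2) ^ (i + k) := by gcongr
      _ = (1 / 2) ^ i := by
        rw [pow_add, mul_left_comm, ← mul_pow]; norm_num
  · simp only [hN]
    exact (h2.norm.pow 2).comp (tendsto_add_atTop_nat _)

/-! ### The isometry of the direct sum with `l²` -/

variable {K : ℕ → Type*} [∀ i, NormedAddCommGroup (K i)] [∀ i, InnerProductSpace 𝕜 (K i)]

theorem inner_sumBasis (b : ∀ i, ℕ → K i) (n : ℕ) (x : lp K 2) :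
    inner 𝕜 (sumBasis b n) x = inner 𝕜 (b n.unpair.1 n.unpair.2) (x n.unpair.1) :=
  lp.inner_single_left _ _ _

theorem inner_sumBasis_pair (b : ∀ i, ℕ → K i) (i j : ℕ) (x : lp K 2) :
    inner 𝕜 (sumBasis b (Nat.pair i j)) x = inner 𝕜 (b i j) (x i) := by
  rw [inner_sumBasis]
  -- The type of the vectors depends on the first component, so both are generalized together.
  generalize hz : (Nat.pair i j).unpair = z
  rw [Nat.unpair_pair] at hz
  subst hz
  rfl

theorem orthonormal_sumBasis {b : ∀ i, ℕ → K i} (hb : ∀ i, Orthonormal 𝕜 (b i)) :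
    Orthonormal 𝕜 (sumBasis b) := by
  classical
  rw [orthonormal_iff_ite]
  intro m n
  rw [inner_sumBasis]
  by_cases h : m.unpair.1 = n.unpair.1
  · have h1 : sumBasis b n m.unpair.1 = b m.unpair.1 n.unpair.2 := by
      rw [sumBasis, ← h, lp.single_apply_self]
    rw [h1, orthonormal_iff_ite.1 (hb _)]
    congr 1
    refine propext ⟨fun h2 => ?_, fun h2 => h2 ▸ rfl⟩
    rw [← Nat.pair_unpair m, ← Nat.pair_unpair n, h, h2]
  · rw [sumBasis, lp.single_apply_ne _ _ _ h, inner_zero_right,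
      if_neg fun h2 : m = n => h (h2 ▸ rfl)]

theorem orthogonal_span_sumBasis {b : ∀ i, ℕ → K i}
    (hd : ∀ i, Dense (Submodule.span 𝕜 (Set.range (b i)) : Set (K i))) :
    (Submodule.span 𝕜 (Set.range (sumBasis b)))ᗮ = ⊥ := by
  rw [Submodule.eq_bot_iff]
  intro x hx
  ext i
  refine (hd i).eq_zero_of_inner_right (𝕜 := 𝕜) fun v hv => ?_
  have h0 : ∀ k, inner 𝕜 (b i k) (x i) = 0 := fun k => by
    have h := (Submodule.mem_orthogonal _ _).1 hx _ (Submodule.subset_span ⟨Nat.pair i k, rfl⟩)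
    rwa [inner_sumBasis_pair] at h
  induction hv using Submodule.span_induction with
  | mem _ hv => obtain ⟨k, rfl⟩ := hv; exact h0 k
  | zero => exact inner_zero_left _
  | add _ _ _ _ h1 h2 => rw [inner_add_left, h1, h2, add_zero]
  | smul c _ _ h1 => rw [inner_smul_left, h1, mul_zero]

/-- The isometry of the direct sum onto `l²` that maps `x` to its coordinates with respect to
`sumBasis b`. -/
noncomputable def sumIsometry [∀ i, CompleteSpace (K i)] {b : ∀ i, ℕ → K i}
    (hb : ∀ i, Orthonormal 𝕜 (b i))
    (hd : ∀ i, Dense (Submodule.span 𝕜 (Set.range (b i)) : Set (K i))) :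
    lp K 2 ≃ₗᵢ[𝕜] lp (fun _ : ℕ => 𝕜) 2 :=
  (HilbertBasis.mkOfOrthogonalEqBot (orthonormal_sumBasis hb) (orthogonal_span_sumBasis hd)).repr

section

variable [∀ i, CompleteSpace (K i)] {b : ∀ i, ℕ → K i} (hb : ∀ i, Orthonormal 𝕜 (b i))
    (hd : ∀ i, Dense (Submodule.span 𝕜 (Set.range (b i)) : Set (K i)))

theorem sumIsometry_apply (x : lp K 2) (n : ℕ) :
    sumIsometry hb hd x n = inner 𝕜 (sumBasis b n) x := by
  rw [sumIsometry, HilbertBasis.repr_apply_apply, HilbertBasis.coe_mkOfOrthogonalEqBot]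

theorem sumIsometry_comboNum (n : ℕ) :
    sumIsometry hb hd (comboNum 𝕜 (sumBasis b) n) = comboNum 𝕜 (unitVec 𝕜) n := by
  have h : ∀ k, sumIsometry hb hd (sumBasis b k) = unitVec 𝕜 k := fun k => by
    have h := HilbertBasis.repr_self (HilbertBasis.mkOfOrthogonalEqBot
      (orthonormal_sumBasis hb) (orthogonal_span_sumBasis hd)) k
    rwa [HilbertBasis.coe_mkOfOrthogonalEqBot] at h
  simp only [comboNum, map_sum, map_smul, h]

theorem normedRep_sumBasis_iff {s : ℕ → ℕ} {x : lp K 2} :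
    normedRep 𝕜 (sumBasis b) s x ↔ normedRep 𝕜 (unitVec 𝕜) s (sumIsometry hb hd x) := by
  simp only [normedRep, cauchyRep, ← sumIsometry_comboNum hb hd, LinearIsometryEquiv.dist_map]
  rw [(sumIsometry hb hd).isometry.isEmbedding.tendsto_nhds_iff]
  rfl

end

end Scalars

end TTE

/-! ### Computability of the analysis operator -/

open TTE
theorem theorem3p14 {𝕜 : Type*} [RCLike 𝕜]
    {H : Type*} [NormedAddCommGroup H] [InnerProductSpace 𝕜 H] [CompleteSpace H]
    {K : ℕ → Type*} [∀ i, NormedAddCommGroup (K i)] [∀ i, InnerProductSpace 𝕜 (K i)]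
    [∀ i, CompleteSpace (K i)]
    (d : ℕ → H) (hH : IsComputableHilbert 𝕜 d)
    (e : ∀ i, ℕ → K i) (hK : ∀ i, IsComputableHilbert 𝕜 (e i))
    (b : ∀ i, ℕ → K i) (hb : ∀ i, IsComputableONB 𝕜 (e i) (b i))
    (Λ : ∀ i, H →L[𝕜] K i) (hΛ : IsComputableGFrame d e Λ)
    (hframe : ComputableMap (normedRep 𝕜 d) (normedRep 𝕜 (unitVec 𝕜))
      (frameAnalysis (hΛ.isGFrame.isFrame_inducedFrame
        (fun i => (hb i).orthonormal) (fun i => (hb i).dense_span)))) :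
    ComputableMap (normedRep 𝕜 d) (sumRep 𝕜 e) (gAnalysis hΛ.isGFrame) ∧
    ComputableMap (normedRep 𝕜 d) (fourierRep 𝕜 b) (gAnalysis hΛ.isGFrame) ∧
    ComputableMap (normedRep 𝕜 d) (normedRep 𝕜 (sumBasis b)) (gAnalysis hΛ.isGFrame) := by
  have ho : ∀ i, Orthonormal 𝕜 (b i) := fun i => (hb i).orthonormal
  have hd : ∀ i, Dense (Submodule.span 𝕜 (Set.range (b i)) : Set (K i)) :=
    fun i => (hb i).dense_span
  obtain ⟨g, hg, hgm, hgr⟩ := hframe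
  obtain ⟨G, hG, -, hGr⟩ := hΛ.computable
  obtain ⟨N, hN, hNsq⟩ := exists_primrec_norm_comboNum_sq 𝕜
  have hU : ∀ f, frameAnalysis (hΛ.isGFrame.isFrame_inducedFrame ho hd) f =
      sumIsometry ho hd (gAnalysis hΛ.isGFrame f) := fun f => by
    ext n
    rw [sumIsometry_apply, inner_sumBasis]
    exact ContinuousLinearMap.adjoint_inner_left _ _ _
  simp only [Realizes, hU] at hgr
  have hnorm : ∀ x : lp K 2, ‖sumIsometry ho hd x‖ ^ 2 = ∑' i, ‖x i‖ ^ 2 := fun x => by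
    rw [LinearIsometryEquiv.norm_map, norm_sq_eq_tsum]
  have hsq := computable_compApprox (computable_normSqApprox hN) hg
  choose R hR hRop using fun i => hGr (fun _ => i) i rfl
  refine ⟨?_, ?_, g, hg, hgm, fun p f hp => ?_⟩
  · refine computableMap_of_approximates
      (computable_pairApprox (computable_evalApprox hG) hsq) fun p f hp => ?_
    obtain ⟨s, hs, hs'⟩ := hgr p f hp
    choose y hy hy' using fun i => (hRop i).2.2 p f hp
    refine ⟨_, (approximates_evalApprox hR hy).pair
      ((approximates_normSqApprox N s).comp hs), fun i => ?_, ?_⟩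
    · have hc : component (fun m => y m.unpair.1 m.unpair.2) i = y i := by
        funext n
        simp [component]
      rw [left_interleave, hc]
      exact hy' i
    · rw [right_interleave, ← hnorm]
      exact realRep_norm_sq hNsq hs'
  · refine computableMap_of_approximates
      (computable_pairApprox (computable_compApprox computable_coordApprox hg) hsq)
      fun p f hp => ?_
    obtain ⟨s, hs, hs'⟩ := hgr p f hp
    refine ⟨_, ((approximates_coordApprox s).comp hs).pair
      ((approximates_normSqApprox N s).comp hs), ?_, ?_⟩
    · rw [left_interleave]
      refine seqRep_seqName fun i => seqRep_seqName fun j => ?_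
      simpa [sumIsometry_apply, inner_sumBasis_pair] using scalarRep_coordNum hs' (Nat.pair i j)
    · rw [right_interleave, ← hnorm]
      exact realRep_norm_sq hNsq hs'
  · obtain ⟨s, hs, hs'⟩ := hgr p f hp
    exact ⟨s, hs, (normedRep_sumBasis_iff ho hd).2 hs'⟩
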